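/- Let $\mathcal{L}$ be an arbitrary first-order signature (relation and function symbols). Models have at least two elements. Second-order $\mathcal{L}$-formulas are built from first-order atomic formulas with Boolean connectives, individual quantifiers and quantifiers over relations of any arity (full semantics); they may have free individual variables, and two formulas are equivalent if they have the same truth value in all models under all assignments. A second-order $\mathcal{L}$-formula belongs to $\Sigma^1_1$ if it is equivalent to a formula of the form $\exists S_1\cdots\exists S_m\,\psi$ with $m\ge 0$, where $S_1,\dots,S_m$ are relation variables and $\psi$ is a first-order formula in the signature $\mathcal{L}\cup\{S_1,\dots,S_m\}$. For a fresh $k$-ary relation symbol $R$, let $\mathcal{L}(R)$ be the expansion of $\mathcal{L}$ by $R$, and for an $\mathcal{L}$-model $M$ and $Q\subseteq M^k$ let $(M,Q)$ be the $\mathcal{L}(R)$-expansion of $M$ in which $R$ is interpreted as $Q$. (i) Let $\phi(R)$ be an $\mathcal{L}(R)$-formula of $\Sigma^1_1$ such that $(M,\emptyset)\models\phi(R)$ for every $\mathcal{L}$-model $M$ (under every assignment). Then the $\mathcal{L}(R)$-formula $\neg\phi\vee\forall x_1\cdots\forall x_k\,\neg R x_1\cdots x_k$ belongs to $\Sigma^1_1$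 if and only if $\phi$ is equivalent to a first-order $\mathcal{L}(R)$-formula. (ii) Let $\phi$ be an $\mathcal{L}$-formula of $\Sigma^1_1$. Then the $\mathcal{L}$-formula $\neg\phi$ belongs to $\Sigma^1_1$ if and only if $\phi$ is equivalent to a first-order $\mathcal{L}$-formula. -/

import Mathlib

universe u v w x

namespace SecondOrder

/-- The single symbol of the signature that consists of one `k`-ary relation symbol. -/
inductive RelSymbol (k : ℕ) : ℕ → Type
  | R : RelSymbol k k

/-- The signature with exactly one symbol, a `k`-ary relation symbol. -/
def oneRel (k : ℕ) : FirstOrder.Language.{0, 0} := ⟨fun _ => Empty, RelSymbol k⟩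

/-- The signature `L(R)`: the expansion of `L` by a fresh `k`-ary relation symbol `R`. -/
def addRel (L : FirstOrder.Language.{u, v}) (k : ℕ) : FirstOrder.Language.{u, v} := L.sum (oneRel k)

/-- The fresh `k`-ary relation symbol `R` of the signature `L(R)`. -/
def newRel (L : FirstOrder.Language.{u, v}) (k : ℕ) : (addRel L k).Relations k := Sum.inr RelSymbol.R

/-- The `L(R)`-expansion `(M, Q)` of an `L`-structure `M`, in which the symbols of `L` keep their
meaning and the new `k`-ary relation symbol is interpreted as `Q`. -/
@[reducible] def expand {L : FirstOrder.Language.{u, v}} {M : Type x} (S : L.Structure M) {k : ℕ} (Q : Set (Fin k → M)) :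
    (addRel L k).Structure M where
  funMap := fun {_} f => match f with
    | Sum.inl f => S.funMap f
    | Sum.inr f => Empty.elim f
  RelMap := fun {_} r => match r with
    | Sum.inl r => S.RelMap r
    | Sum.inr RelSymbol.R => fun xs => xs ∈ Q

/-- Second-order formulas of signature `L`, with free individual variables indexed by `α` and
bound individual variables indexed by `Fin n` (the conventions of Mathlib's `BoundedFormula`), and
with quantification over relations of any arity. The variable of a relation quantifier is a
fresh relation symbol added to the signature. -/
inductive BoundedSOFormula (α : Type w) :
    FirstOrder.Language.{u, v} → ℕ → Type (max (u + 1) (v + 1) w)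
  | falsum {L : FirstOrder.Language.{u, v}} {n : ℕ} : BoundedSOFormula α L n
  | equal {L : FirstOrder.Language.{u, v}} {n : ℕ} (t₁ t₂ : L.Term (α ⊕ Fin n)) : BoundedSOFormula α L n
  | rel {L : FirstOrder.Language.{u, v}} {n l : ℕ} (r : L.Relations l) (ts : Fin l → L.Term (α ⊕ Fin n)) :
      BoundedSOFormula α L n
  | imp {L : FirstOrder.Language.{u, v}} {n : ℕ} (φ ψ : BoundedSOFormula α L n) : BoundedSOFormula α L n
  | all {L : FirstOrder.Language.{u, v}} {n : ℕ} (φ : BoundedSOFormula α L (n + 1)) : BoundedSOFormula α L n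
  | allRel {L : FirstOrder.Language.{u, v}} {n : ℕ} (k : ℕ) (φ : BoundedSOFormula α (addRel L k) n) :
      BoundedSOFormula α L n

/-- Second-order `L`-formulas with free individual variables indexed by `α`. -/
abbrev SOFormula (L : FirstOrder.Language.{u, v}) (α : Type w) := BoundedSOFormula α L 0

namespace BoundedSOFormula

variable {α : Type w}

/-- Standard (full) semantics of second-order formulas: relation quantifiers range over all
relations on the domain. -/
def Realize {M : Type x} : {L : FirstOrder.Language.{u, v}} → {n : ℕ} → BoundedSOFormula α L n →
    L.Structure M → (α → M) → (Fin n → M) → Prop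
  | _, _, falsum, _, _, _ => False
  | _, _, equal t₁ t₂, _, s, xs => t₁.realize (Sum.elim s xs) = t₂.realize (Sum.elim s xs)
  | _, _, rel r ts, S, s, xs => S.RelMap r fun i => (ts i).realize (Sum.elim s xs)
  | _, _, imp φ ψ, S, s, xs => φ.Realize S s xs → ψ.Realize S s xs
  | _, _, all φ, S, s, xs => ∀ a : M, φ.Realize S s (Fin.snoc xs a)
  | _, _, allRel k φ, S, s, xs => ∀ Q : Set (Fin k → M), φ.Realize (expand S Q) s xs

/-- Negation. -/
def not {L : FirstOrder.Language.{u, v}} {n : ℕ} (φ : BoundedSOFormula α L n) : BoundedSOFormula α L n :=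
  φ.imp falsum

/-- Disjunction. -/
def or {L : FirstOrder.Language.{u, v}} {n : ℕ} (φ ψ : BoundedSOFormula α L n) : BoundedSOFormula α L n :=
  φ.not.imp ψ

/-- Existential quantification over `k`-ary relations. -/
def exRel {L : FirstOrder.Language.{u, v}} {n : ℕ} (k : ℕ) (φ : BoundedSOFormula α (addRel L k) n) :
    BoundedSOFormula α L n :=
  (allRel k φ.not).not

/-- First-order formulas (in Mathlib's sense) as second-order formulas. -/
def ofFirstOrder {L : FirstOrder.Language.{u, v}} :
    {n : ℕ} → L.BoundedFormula α n → BoundedSOFormula α L n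
  | _, .falsum => falsum
  | _, .equal t₁ t₂ => equal t₁ t₂
  | _, .rel r ts => rel r ts
  | _, .imp φ ψ => imp (ofFirstOrder φ) (ofFirstOrder ψ)
  | _, .all φ => all (ofFirstOrder φ)

theorem realize_not {M : Type x} {L : FirstOrder.Language.{u, v}} {n : ℕ} (φ : BoundedSOFormula α L n)
    (S : L.Structure M) (s : α → M) (xs : Fin n → M) :
    φ.not.Realize S s xs ↔ ¬ φ.Realize S s xs := Iff.rfl

theorem realize_or {M : Type x} {L : FirstOrder.Language.{u, v}} {n : ℕ} (φ ψ : BoundedSOFormula α L n)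
    (S : L.Structure M) (s : α → M) (xs : Fin n → M) :
    (φ.or ψ).Realize S s xs ↔ φ.Realize S s xs ∨ ψ.Realize S s xs := by
  simp only [or, not, Realize]
  tauto

theorem realize_exRel {M : Type x} {L : FirstOrder.Language.{u, v}} {n k : ℕ}
    (φ : BoundedSOFormula α (addRel L k) n)
    (S : L.Structure M) (s : α → M) (xs : Fin n → M) :
    (exRel k φ).Realize S s xs ↔ ∃ Q : Set (Fin k → M), φ.Realize (expand S Q) s xs := by
  simp only [exRel, not, Realize, imp_false, not_forall, not_not]

theorem realize_ofFirstOrder {M : Type x} {L : FirstOrder.Language.{u, v}} {n : ℕ} (θ : L.BoundedFormula α n)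
    (S : L.Structure M) (s : α → M) (xs : Fin n → M) :
    (ofFirstOrder θ).Realize S s xs ↔ θ.Realize s xs := by
  induction θ with
  | falsum => exact Iff.rfl
  | equal => exact Iff.rfl
  | rel => exact Iff.rfl
  | imp _ _ h₁ h₂ => exact imp_congr (h₁ xs) (h₂ xs)
  | all _ h => exact forall_congr' fun a => h (Fin.snoc xs a)

end BoundedSOFormula

/-- Truth of a second-order formula in an `L`-structure `M` under an assignment `s`. -/
def SOFormula.Realize {M : Type x} {L : FirstOrder.Language.{u, v}} {α : Type w} (φ : SOFormula L α)
    (S : L.Structure M) (s : α → M) : Prop :=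
  BoundedSOFormula.Realize φ S s Fin.elim0

/-- Logical equivalence: the same truth value in all models under all assignments. As usual in
this setting, models have at least two elements. -/
def SOFormula.Equivalent {L : FirstOrder.Language.{u, v}} {α : Type w} (φ ψ : SOFormula L α) : Prop :=
  ∀ (M : Type (max u v w)) [Nontrivial M] (S : L.Structure M) (s : α → M),
    φ.Realize S s ↔ ψ.Realize S s

/-- The formulas of the form `∃ R₁ … ∃ Rₘ θ` with `θ` first-order (`m = 0` is allowed). -/
inductive SOFormula.IsExistentialForm {α : Type w} :
    {L : FirstOrder.Language.{u, v}} → SOFormula L α → Prop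
  | firstOrder {L : FirstOrder.Language.{u, v}} (θ : L.Formula α) :
      IsExistentialForm (BoundedSOFormula.ofFirstOrder θ)
  | exRel {L : FirstOrder.Language.{u, v}} (k : ℕ) (φ : SOFormula (addRel L k) α) :
      IsExistentialForm φ → IsExistentialForm (BoundedSOFormula.exRel k φ)

/-- `φ` belongs to `Σ¹₁`. -/
def SOFormula.IsSigma11 {L : FirstOrder.Language.{u, v}} {α : Type w} (φ : SOFormula L α) : Prop :=
  ∃ ψ : SOFormula L α, ψ.IsExistentialForm ∧ φ.Equivalent ψ

/-- `φ` is equivalent to a first-order formula of the same signature. -/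
def SOFormula.IsEquivFirstOrder {L : FirstOrder.Language.{u, v}} {α : Type w} (φ : SOFormula L α) : Prop :=
  ∃ θ : L.Formula α, φ.Equivalent (BoundedSOFormula.ofFirstOrder θ)

/-- The first-order `L(R)`-formula `∀ x₁ … ∀ xₖ ¬ R x₁ … xₖ`. -/
def relEmpty (L : FirstOrder.Language.{u, v}) (α : Type w) (k : ℕ) : (addRel L k).Formula α :=
  FirstOrder.Language.BoundedFormula.alls
    (FirstOrder.Language.BoundedFormula.not
      (FirstOrder.Language.Relations.boundedFormula (newRel L k)
        fun i : Fin k => FirstOrder.Language.Term.var (Sum.inr i)))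

theorem realize_relEmpty {L : FirstOrder.Language.{u, v}} {α : Type w} {M : Type x} {k : ℕ}
    (S : L.Structure M) (Q : Set (Fin k → M)) (s : α → M) :
    SOFormula.Realize (BoundedSOFormula.ofFirstOrder (relEmpty L α k)) (expand S Q) s ↔
      Q = ∅ := by
  let := expand S Q
  rw [SOFormula.Realize, BoundedSOFormula.realize_ofFirstOrder]
  have h : (relEmpty L α k).Realize s ↔ ∀ xs : Fin k → M, xs ∉ Q := by
    rw [relEmpty, FirstOrder.Language.BoundedFormula.realize_alls]
    exact Iff.rfl
  rw [Set.eq_empty_iff_forall_notMem, ← h, FirstOrder.Language.Formula.Realize]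
  exact iff_of_eq (congrArg _ (Subsingleton.elim _ _))

end SecondOrder

universe y

namespace SecondOrder

open FirstOrder FirstOrder.Language

/-! Both parts are the same application of Craig interpolation. Suppose `φ` and `¬φ ∨ ρ` are both
Σ¹₁, where `ρ` is first-order and implies `φ`. Write `φ` as "some expansion by `P₁` satisfies `ψ₁`"
and `¬φ ∨ ρ` as "some expansion by `P₂` satisfies `χ₁`". Then `ψ₁ ∧ ¬ρ` and `χ₁` are incompatible
over every `L`-structure and share only symbols of `L`, so an `L`-formula `θ` separates them, and
`φ` is equivalent to `θ ∨ ρ` (`SOFormula.IsSigma11.isEquivFirstOrder`). Part (i) takes for `ρ` the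
statement that `R` is empty, part (ii) takes `⊥`. The converses only negate a first-order formula.

Interpolation (`exists_interpolant`) is proved by inseparable pairs. Only finitely many symbols of
`L` and finitely many free variables occur, so the signatures may be taken countable and the
variables in `ℕ`. If no formula of the common language separates `φ` from `χ`, a generic ideal of
stronger inseparable pairs decides every formula and supplies Henkin witnesses on both sides
(`Insep.exists_common_reduct`). The two resulting theories agree on the common language, so both
have models on the same quotient of `ℕ` with the same reduct. This contradicts incompatibility. -/

/-- Truth of a first-order formula in an explicitly given structure. -/
def Sat {L : FirstOrder.Language.{u, v}} {M : Type x} {β : Type w} (S : L.Structure M) (φ : L.Formula β)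
    (s : β → M) : Prop :=
  φ.Realize s

/-! ### Truth in explicitly given structures -/

section Sat

variable {L : FirstOrder.Language.{u, v}} {M : Type x} {β : Type w} (S : L.Structure M)

theorem sat_not (φ : L.Formula β) (s : β → M) : Sat S φ.not s ↔ ¬ Sat S φ s := Iff.rfl

theorem sat_inf (φ ψ : L.Formula β) (s : β → M) : Sat S (φ ⊓ ψ) s ↔ Sat S φ s ∧ Sat S ψ s :=
  Formula.realize_inf

theorem sat_sup (φ ψ : L.Formula β) (s : β → M) : Sat S (φ ⊔ ψ) s ↔ Sat S φ s ∨ Sat S ψ s :=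
  Formula.realize_sup

theorem sat_bot (s : β → M) : ¬ Sat S (⊥ : L.Formula β) s := id

theorem sat_relabel {γ : Type*} (φ : L.Formula β) (g : β → γ) (s : γ → M) :
    Sat S (φ.relabel g) s ↔ Sat S φ (s ∘ g) :=
  Formula.realize_relabel

theorem sat_iExs (φ : L.Formula (β ⊕ Unit)) (s : β → M) :
    Sat S (φ.iExs Unit) s ↔ ∃ a : M, Sat S φ (Sum.elim s fun _ => a) :=
  Formula.realize_iExs.trans
    ⟨fun ⟨i, h⟩ => ⟨i (), h⟩, fun ⟨a, h⟩ => ⟨fun _ => a, h⟩⟩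

theorem sat_onFormula {L' : FirstOrder.Language.{u, v}} (g : L →ᴸ L') (S' : L'.Structure M) (φ : L.Formula β)
    (s : β → M) : Sat S' (g.onFormula φ) s ↔ Sat (g.reduct M) φ s :=
  let := g.reduct M
  g.realize_onFormula φ

theorem sat_congr_of_finset (φ : L.Formula β) :
    ∃ t : Finset β, ∀ (M : Type x) (S : L.Structure M) (s s' : β → M),
      (∀ a ∈ t, s a = s' a) → (Sat S φ s ↔ Sat S φ s') := by
  classical
  refine ⟨φ.freeVarFinset, fun M S s s' h => ?_⟩
  have h₁ := BoundedFormula.realize_restrictFreeVar (φ := φ) (f := id)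
    (v := fun a => s a) (xs := (default : Fin 0 → M)) s fun _ => rfl
  have h₂ := BoundedFormula.realize_restrictFreeVar (φ := φ) (f := id)
    (v := fun a => s a) (xs := (default : Fin 0 → M)) s' fun a => h a a.2
  exact h₁.symm.trans h₂

end Sat

/-! ### Henkin sets and their term models -/

/-- A finitely satisfiable, complete set of formulas with the Henkin property is the set of all
formulas true in a structure on any type that names its elements by the variables according to
the equations in the set. -/
theorem exists_structure_of_henkin {L : FirstOrder.Language.{u, v}} (G : Set (L.Formula ℕ))
    (hfin : ∀ t : Finset (L.Formula ℕ), ↑t ⊆ G →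
      ∃ (M : Type x) (_ : Nonempty M) (S : L.Structure M) (s : ℕ → M), ∀ σ ∈ t, Sat S σ s)
    (hdec : ∀ σ : L.Formula ℕ, σ ∈ G ∨ σ.not ∈ G)
    (hhen : ∀ σ : L.Formula (ℕ ⊕ Unit),
      (σ.iExs Unit).not ∈ G ∨ ∃ i : ℕ, σ.relabel (Sum.elim id fun _ => i) ∈ G)
    {K : Type w} (c : ℕ → K) (hc : Function.Surjective c)
    (heq : ∀ i j, c i = c j ↔ Term.equal (Term.var i) (Term.var j) ∈ G) :
    ∃ S : L.Structure K, ∀ σ : L.Formula ℕ, Sat S σ c ↔ σ ∈ G := by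
  -- Variables become constants of `L[[ℕ]]`, so that compactness for sentences applies.
  classical
  let T : L[[ℕ]].Theory := Formula.equivSentence '' G
  have hT : T.IsSatisfiable := by
    rw [Theory.isSatisfiable_iff_isFinitelySatisfiable]
    intro T₀ hT₀
    obtain ⟨t, htG, rfl⟩ := Finset.subset_set_image_iff.1 hT₀
    obtain ⟨M, _, S, s, hs⟩ := hfin t htG
    let := constantsOn.structure s
    have : M ⊨ (↑(t.image Formula.equivSentence) : L[[ℕ]].Theory) := by
      refine ⟨fun φ hφ => ?_⟩
      rw [Finset.coe_image] at hφ
      obtain ⟨σ, hσ, rfl⟩ := hφ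
      exact (Formula.realize_equivSentence M σ).2 (hs σ hσ)
    exact Theory.Model.isSatisfiable M
  obtain ⟨A⟩ := hT
  let : L.Structure A := (L.lhomWithConstants ℕ).reduct A
  let s : ℕ → A := fun i => (L.con i : A)
  have hA₁ : ∀ σ ∈ G, σ.Realize s := fun σ hσ =>
    (Formula.realize_equivSentence A σ).1
      (Theory.realize_sentence_of_mem T (Set.mem_image_of_mem _ hσ))
  have hA : ∀ σ, σ.Realize s ↔ σ ∈ G := fun σ =>
    ⟨fun h => (hdec σ).resolve_right fun hn => hA₁ _ hn h, hA₁ σ⟩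
  -- A nonempty set definable over named elements contains a named element. This yields both closure
  -- under functions and the Tarski–Vaught test.
  have hwit : ∀ (σ : L.Formula (ℕ ⊕ Unit)) (a : A), σ.Realize (Sum.elim s fun _ => a) →
      ∃ i, σ.Realize (Sum.elim s fun _ => s i) := by
    intro σ a ha
    rcases hhen σ with h | ⟨i, hi⟩
    · exact absurd ((sat_iExs _ σ s).2 ⟨a, ha⟩) (hA₁ _ h)
    · refine ⟨i, ?_⟩
      have := Formula.realize_relabel.1 (hA₁ _ hi)
      convert this using 1
      ext (_ | _) <;> rfl
  let N₀ : L.Substructure A :=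
    { carrier := Set.range s
      fun_mem := by
        intro n f xs hxs
        choose j hj using hxs
        let σ : L.Formula (ℕ ⊕ Unit) :=
          Term.equal (Term.func f fun k => Term.var (Sum.inl (j k))) (Term.var (Sum.inr ()))
        have key : ∀ b : A, σ.Realize (Sum.elim s fun _ => b) ↔ Structure.funMap f xs = b := by
          intro b
          rw [Formula.realize_equal]
          simp [hj]
        obtain ⟨i, hi⟩ := hwit σ _ ((key _).2 rfl)
        exact ⟨i, ((key _).1 hi).symm⟩ }
  have hN : N₀.IsElementary := by
    refine N₀.isElementary_of_exists fun n φ x a ha => ?_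
    choose j hj using fun k => (x k).2
    let g : Empty ⊕ Fin (n + 1) → ℕ ⊕ Unit :=
      Sum.elim Empty.elim (Fin.snoc (α := fun _ => ℕ ⊕ Unit) (Sum.inl ∘ j) (Sum.inr ()))
    have key : ∀ b : A, (φ.toFormula.relabel g).Realize (Sum.elim s fun _ => b) ↔
        φ.Realize default (Fin.snoc (α := fun _ => A) ((↑) ∘ x) b) := by
      intro b
      rw [Formula.realize_relabel, BoundedFormula.realize_toFormula]
      have e : ((Sum.elim s fun _ => b) ∘ g) ∘ Sum.inr = Fin.snoc (α := fun _ => A) ((↑) ∘ x) b := by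
        ext k
        refine Fin.lastCases ?_ (fun k => ?_) k
        · simp [g]
        · simp [g, hj]
      rw [e, Subsingleton.elim (((Sum.elim s fun _ => b) ∘ g) ∘ Sum.inl) default]
    obtain ⟨i, hi⟩ := hwit _ a ((key a).2 ha)
    exact ⟨⟨s i, i, rfl⟩, (key _).1 hi⟩
  let N : L.ElementarySubstructure A := ⟨N₀, hN⟩
  let r : ℕ → N := fun i => ⟨s i, i, rfl⟩
  have hr : Function.Surjective r := by
    rintro ⟨_, i, hi⟩
    exact ⟨i, Subtype.ext hi⟩
  have hN' : ∀ σ, σ.Realize r ↔ σ ∈ G := fun σ =>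
    (N.subtype.map_formula σ r).symm.trans (hA σ)
  have hrc : ∀ i j, r i = r j ↔ c i = c j := fun i j => by
    rw [heq, ← hN']; rfl
  -- The named elements of `A` and the points of `K` satisfy the same equations, so matching names
  -- is a bijection along which the structure is transported.
  let e : N ≃ K := Equiv.ofBijective (fun a => c (Function.surjInv hr a)) (by
    constructor
    · intro a b hab
      have := (hrc _ _).2 hab
      rwa [Function.surjInv_eq hr, Function.surjInv_eq hr] at this
    · intro k
      obtain ⟨i, rfl⟩ := hc k
      exact ⟨r i, (hrc _ _).1 (Function.surjInv_eq hr _)⟩)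
  have her : e ∘ r = c := funext fun i => (hrc _ _).1 (Function.surjInv_eq hr _)
  let S : L.Structure K := e.inducedStructure
  refine ⟨S, fun σ => ?_⟩
  rw [← hN', ← her]
  exact StrongHomClass.realize_formula (Equiv.inducedStructureEquiv (L := L) e) σ

/-- Semantic consequence over structures in `Type x` with at least two elements. -/
def Entails {L : FirstOrder.Language.{u, v}} (φ σ : L.Formula ℕ) : Prop :=
  ∀ (M : Type x) [Nontrivial M] (S : L.Structure M) (s : ℕ → M), Sat S φ s → Sat S σ s

namespace Entails

variable {L : FirstOrder.Language.{u, v}} {φ σ τ : L.Formula ℕ}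

theorem refl (φ : L.Formula ℕ) : Entails.{u, v, x} φ φ := fun _ _ _ _ h => h

theorem trans (h : Entails.{u, v, x} φ σ) (h' : Entails.{u, v, x} σ τ) : Entails.{u, v, x} φ τ :=
  fun M _ S s hs => h' M S s (h M S s hs)

end Entails

/-- A directed set of satisfiable formulas in which every existential formula is refuted or
witnessed by a variable. -/
structure IsHenkinFilter {L : FirstOrder.Language.{u, v}} (D : Set (L.Formula ℕ)) : Prop where
  nonempty : D.Nonempty
  directed : DirectedOn (fun φ ψ => Entails.{u, v, x} ψ φ) D
  satisfiable : ∀ φ ∈ D, ∃ (M : Type x) (_ : Nontrivial M) (S : L.Structure M) (s : ℕ → M), Sat S φ s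
  henkin : ∀ σ : L.Formula (ℕ ⊕ Unit), ∃ φ ∈ D, Entails.{u, v, x} φ (σ.iExs Unit).not ∨
    ∃ i : ℕ, Entails.{u, v, x} φ (σ.relabel (Sum.elim id fun _ => i))

namespace IsHenkinFilter

variable {L : FirstOrder.Language.{u, v}} {D : Set (L.Formula ℕ)}

/-- Apply the Henkin condition to `σ` with a vacuous quantifier: refuting or witnessing `∃ y, σ`
amounts to refuting or affirming `σ`. -/
theorem decides (hD : IsHenkinFilter.{u, v, x} D) (σ : L.Formula ℕ) :
    (∃ φ ∈ D, Entails.{u, v, x} φ σ) ∨ ∃ φ ∈ D, Entails.{u, v, x} φ σ.not := by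
  obtain ⟨φ, hφ, h | ⟨i, h⟩⟩ := hD.henkin (σ.relabel Sum.inl)
  · refine Or.inr ⟨φ, hφ, fun M _ S s hs hσ => h M S s hs ?_⟩
    exact (sat_iExs S _ s).2 ⟨s 0, (sat_relabel S _ _ _).2 hσ⟩
  · refine Or.inl ⟨φ, hφ, fun M _ S s hs => ?_⟩
    have := h M S s hs
    rwa [sat_relabel, sat_relabel] at this

/-- By directedness, finitely many consequences of `D` follow from one member of `D`, which has a
model; this is the finite satisfiability that compactness needs. -/
theorem exists_structure (hD : IsHenkinFilter.{u, v, x} D) {K : Type w} (c : ℕ → K)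
    (hc : Function.Surjective c)
    (heq : ∀ i j, c i = c j ↔
      ∃ φ ∈ D, Entails.{u, v, x} φ (Term.equal (Term.var i) (Term.var j))) :
    ∃ S : L.Structure K, ∀ σ : L.Formula ℕ, Sat S σ c ↔ ∃ φ ∈ D, Entails.{u, v, x} φ σ := by
  classical
  refine exists_structure_of_henkin.{u, v, w, x} {σ | ∃ φ ∈ D, Entails.{u, v, x} φ σ} ?_ hD.decides ?_ c
    hc heq
  · intro t ht
    have : ∃ φ ∈ D, ∀ σ ∈ t, Entails.{u, v, x} φ σ := by
      induction t using Finset.induction_on with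
      | empty => exact hD.nonempty.imp fun φ h => ⟨h, by simp⟩
      | insert σ t _ ih =>
        rw [Finset.coe_insert, Set.insert_subset_iff] at ht
        obtain ⟨⟨φ₁, h₁, h₁'⟩, ht⟩ := ht
        obtain ⟨φ₂, h₂, h₂'⟩ := ih ht
        obtain ⟨φ, h, hφ₁, hφ₂⟩ := hD.directed φ₁ h₁ φ₂ h₂
        refine ⟨φ, h, fun τ hτ => ?_⟩
        rcases Finset.mem_insert.1 hτ with rfl | hτ
        exacts [hφ₁.trans h₁', hφ₂.trans (h₂' τ hτ)]
    obtain ⟨φ, hφ, h⟩ := this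
    obtain ⟨M, _, S, s, hs⟩ := hD.satisfiable φ hφ
    exact ⟨M, inferInstance, S, s, fun σ hσ => h σ hσ M S s hs⟩
  · intro σ
    obtain ⟨φ, hφ, h | ⟨i, h⟩⟩ := hD.henkin σ
    exacts [Or.inl ⟨φ, hφ, h⟩, Or.inr ⟨i, φ, hφ, h⟩]

/-- The equations between variables that hold in a Henkin filter. -/
def setoid (hD : IsHenkinFilter.{u, v, x} D) : Setoid ℕ where
  r i j := ∃ φ ∈ D, Entails.{u, v, x} φ (Term.equal (Term.var i) (Term.var j))
  iseqv :=
    { refl := fun _ => hD.nonempty.imp fun _ h => ⟨h, fun _ _ _ _ _ => rfl⟩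
      symm := fun ⟨φ, hφ, h⟩ => ⟨φ, hφ, fun M _ S s hs =>
        Formula.realize_equal.2 (Formula.realize_equal.1 (h M S s hs)).symm⟩
      trans := fun ⟨φ₁, h₁, h₁'⟩ ⟨φ₂, h₂, h₂'⟩ => by
        obtain ⟨φ, h, hφ₁, hφ₂⟩ := hD.directed φ₁ h₁ φ₂ h₂
        exact ⟨φ, h, fun M _ S s hs => Formula.realize_equal.2 <|
          (Formula.realize_equal.1 (hφ₁.trans h₁' M S s hs)).trans
            (Formula.realize_equal.1 (hφ₂.trans h₂' M S s hs))⟩ }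

end IsHenkinFilter

/-! ### Inseparable pairs of formulas -/

section Inseparable

variable {L L₁ L₂ : FirstOrder.Language.{u, v}} (g₁ : L →ᴸ L₁) (g₂ : L →ᴸ L₂)

/-- No formula of the common language separates `φ` from `χ`. -/
def Insep (φ : L₁.Formula ℕ) (χ : L₂.Formula ℕ) : Prop :=
  ∀ θ : L.Formula ℕ, Entails.{u, v, x} φ (g₁.onFormula θ) →
    ¬ Entails.{u, v, x} χ (g₂.onFormula θ).not

variable {g₁ g₂} {φ : L₁.Formula ℕ} {χ : L₂.Formula ℕ}

/-- The negation of a separator separates in the other direction. -/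
theorem Insep.symm (h : Insep.{u, v, x} g₁ g₂ φ χ) : Insep.{u, v, x} g₂ g₁ χ φ := by
  intro θ h₁ h₂
  refine h θ.not h₂ fun M _ S s hs => (sat_not S _ s).2 fun hn => ?_
  rw [sat_onFormula, sat_not, ← sat_onFormula] at hn
  exact hn (h₁ M S s hs)

/-- Otherwise `⊥` would be a separator. -/
theorem Insep.satisfiable (h : Insep.{u, v, x} g₁ g₂ φ χ) :
    ∃ (M : Type x) (_ : Nontrivial M) (S : L₁.Structure M) (s : ℕ → M), Sat S φ s := by
  by_contra hn
  refine h ⊥ (fun M _ S s hs => (hn ⟨M, inferInstance, S, s, hs⟩).elim) fun M _ S s _ =>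
    (sat_not S _ s).2 fun hb => ?_
  rw [sat_onFormula] at hb
  exact hb

/-- If `θ₁` and `θ₂` separate the two strengthenings from `χ`, then `θ₁ ⊔ θ₂` separates `φ` itself.
-/
theorem Insep.inf_or_inf_not (h : Insep.{u, v, x} g₁ g₂ φ χ) (σ : L₁.Formula ℕ) :
    Insep.{u, v, x} g₁ g₂ (φ ⊓ σ) χ ∨ Insep.{u, v, x} g₁ g₂ (φ ⊓ σ.not) χ := by
  by_contra hn
  simp only [Insep, not_or, not_forall, not_not] at hn
  obtain ⟨⟨θ₁, h₁, h₁'⟩, θ₂, h₂, h₂'⟩ := hn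
  refine h (θ₁ ⊔ θ₂) (fun M _ S s hs => ?_) fun M _ S s hs =>
    (sat_not S _ s).2 fun hθ => ?_
  · rw [sat_onFormula, sat_sup, ← sat_onFormula, ← sat_onFormula]
    by_cases hσ : Sat S σ s
    · exact Or.inl (h₁ M S s ((sat_inf S _ _ _).2 ⟨hs, hσ⟩))
    · exact Or.inr (h₂ M S s ((sat_inf S _ _ _).2 ⟨hs, hσ⟩))
  · rw [sat_onFormula, sat_sup, ← sat_onFormula, ← sat_onFormula] at hθ
    exact hθ.elim (h₁' M S s hs) (h₂' M S s hs)

/-- One step of the Henkin construction: either `¬∃ y, σ` can be added, or `∃ y, σ` can be added and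
witnessed by a fresh variable `i`. If `θ` separated the witnessed formula from `χ`, then `∃ xᵢ, θ`
would separate `φ ∧ ∃ y, σ` from `χ`. -/
theorem Insep.exists_henkin (h : Insep.{u, v, x} g₁ g₂ φ χ) (σ : L₁.Formula (ℕ ⊕ Unit)) :
    ∃ φ' : L₁.Formula ℕ, Entails.{u, v, x} φ' φ ∧ Insep.{u, v, x} g₁ g₂ φ' χ ∧
      (Entails.{u, v, x} φ' (σ.iExs Unit).not ∨
        ∃ i : ℕ, Entails.{u, v, x} φ' (σ.relabel (Sum.elim id fun _ => i))) := by
  classical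
  rcases h.inf_or_inf_not (σ.iExs Unit) with h' | h'
  swap
  · exact ⟨_, fun M _ S s hs => ((sat_inf S _ _ s).1 hs).1, h',
      Or.inl fun M _ S s hs => ((sat_inf S _ _ s).1 hs).2⟩
  obtain ⟨t₁, ht₁⟩ := sat_congr_of_finset.{u, v, 0, x} φ
  obtain ⟨t₂, ht₂⟩ := sat_congr_of_finset.{u, v, 0, x} χ
  obtain ⟨t₃, ht₃⟩ := sat_congr_of_finset.{u, v, 0, x} σ
  obtain ⟨i, hi⟩ := Infinite.exists_notMem_finset (t₁ ∪ t₂ ∪ t₃.preimage Sum.inl Sum.inl_injective.injOn)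
  simp only [Finset.mem_union, Finset.mem_preimage, not_or] at hi
  obtain ⟨⟨hi₁, hi₂⟩, hi₃⟩ := hi
  refine ⟨φ ⊓ σ.relabel (Sum.elim id fun _ => i), fun M _ S s hs => ((sat_inf S _ _ s).1 hs).1, ?_,
    Or.inr ⟨i, fun M _ S s hs => ((sat_inf S _ _ s).1 hs).2⟩⟩
  intro θ hθ₁ hθ₂
  -- This is `∃ xᵢ, θ`: only the variable `i` is sent to the quantified slot.
  let θ' : L.Formula ℕ := (θ.relabel fun j => if j = i then Sum.inr () else Sum.inl j).iExs Unit
  have hθ' : ∀ {M : Type x} (S : L.Structure M) (s : ℕ → M),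
      Sat S θ' s ↔ ∃ a, Sat S θ (Function.update s i a) := by
    intro M S s
    rw [sat_iExs]
    refine exists_congr fun a => ?_
    rw [sat_relabel]
    apply iff_of_eq
    congr 1
    ext j
    by_cases hj : j = i
    · subst hj; simp
    · simp [hj]
  have hupd : ∀ {M : Type x} (s : ℕ → M) (a : M) {t : Finset ℕ}, i ∉ t → ∀ j ∈ t,
      s j = Function.update s i a j := fun s a t hit j hj => by
    rw [Function.update_of_ne]
    rintro rfl
    exact hit hj
  refine h' θ' (fun M _ S s hs => ?_) fun M _ S s hs =>
    (sat_not S _ s).2 fun hθ => ?_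
  · rw [sat_inf, sat_iExs] at hs
    obtain ⟨hs, a, ha⟩ := hs
    rw [sat_onFormula, hθ']
    refine ⟨a, ?_⟩
    rw [← sat_onFormula]
    refine hθ₁ M S _ ((sat_inf S _ _ _).2 ⟨(ht₁ M S _ _ (hupd s a hi₁)).1 hs, ?_⟩)
    rw [sat_relabel]
    refine (ht₃ M S _ _ ?_).1 ha
    rintro (j | _) hj
    · refine (Function.update_of_ne (f := s) ?_ a).symm
      rintro rfl
      exact hi₃ hj
    · simp
  · rw [sat_onFormula, hθ'] at hθ
    obtain ⟨a, ha⟩ := hθ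
    rw [← sat_onFormula] at ha
    exact hθ₂ M S _ ((ht₂ M S _ _ (hupd s a hi₂)).1 hs) ha

variable (g₁ g₂)

/-- The inseparable pairs of formulas, ordered by strength. -/
structure InsepPair where
  /-- the formula of the first language -/
  fst : L₁.Formula ℕ
  /-- the formula of the second language -/
  snd : L₂.Formula ℕ
  insep : Insep.{u, v, x} g₁ g₂ fst snd

instance : Preorder (InsepPair.{u, v, x} g₁ g₂) where
  le p q := Entails.{u, v, x} q.fst p.fst ∧ Entails.{u, v, x} q.snd p.snd
  le_refl p := ⟨.refl _, .refl _⟩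
  le_trans _ _ _ h h' := ⟨h'.1.trans h.1, h'.2.trans h.2⟩

variable {g₁ g₂}

/-- Every element is named by a variable, so the atomic formulas determine the whole structure. -/
theorem structure_ext_of_sat {L : FirstOrder.Language.{u, v}} {K : Type w} {c : ℕ → K}
    (hc : Function.Surjective c) (S S' : L.Structure K)
    (h : ∀ θ : L.Formula ℕ, Sat S θ c ↔ Sat S' θ c) : S = S' := by
  have hc' : ∀ {n : ℕ} (xs : Fin n → K), ∃ j : Fin n → ℕ, xs = fun k => c (j k) := fun xs =>
    ⟨fun k => (hc (xs k)).choose, funext fun k => ((hc (xs k)).choose_spec).symm⟩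
  ext n f xs
  · obtain ⟨j, rfl⟩ := hc' xs
    obtain ⟨i, hi⟩ := hc (S.funMap f fun k => c (j k))
    exact hi.symm.trans
      ((h (Term.equal (Term.var i) (Term.func f fun k => Term.var (j k)))).1 hi)
  · obtain ⟨j, rfl⟩ := hc' xs
    exact h (f.formula fun k => Term.var (j k))

/-- Inseparable formulas of countable languages hold in structures with a common reduct. -/
theorem Insep.exists_common_reduct [Countable L₁.Symbols] [Countable L₂.Symbols]
    (h : Insep.{u, v, x} g₁ g₂ φ χ) :
    ∃ (K : Type y) (_ : Nontrivial K) (S₁ : L₁.Structure K) (S₂ : L₂.Structure K) (c : ℕ → K),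
      g₁.reduct K = g₂.reduct K ∧ Sat S₁ φ c ∧ Sat S₂ χ c := by
  classical
  let P := InsepPair.{u, v, x} g₁ g₂
  -- One cofinal set for each Henkin requirement on either side. There are countably many, so by
  -- Rasiowa–Sikorski an ideal through `p₀` meets them all.
  let C : L₁.Formula (ℕ ⊕ Unit) ⊕ L₂.Formula (ℕ ⊕ Unit) → Order.Cofinal P := fun σ =>
    σ.elim
      (fun σ =>
        { carrier := {p | Entails.{u, v, x} p.fst (σ.iExs Unit).not ∨
            ∃ i : ℕ, Entails.{u, v, x} p.fst (σ.relabel (Sum.elim id fun _ => i))}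
          isCofinal := fun p => by
            obtain ⟨φ', h₁, h₂, h₃⟩ := p.insep.exists_henkin σ
            exact ⟨⟨φ', p.snd, h₂⟩, h₃, h₁, .refl _⟩ })
      (fun σ =>
        { carrier := {p | Entails.{u, v, x} p.snd (σ.iExs Unit).not ∨
            ∃ i : ℕ, Entails.{u, v, x} p.snd (σ.relabel (Sum.elim id fun _ => i))}
          isCofinal := fun p => by
            obtain ⟨φ', h₁, h₂, h₃⟩ := p.insep.symm.exists_henkin σ
            exact ⟨⟨p.fst, φ', h₂.symm⟩, h₃, .refl _, h₁⟩ })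
  let : Encodable (L₁.Formula (ℕ ⊕ Unit) ⊕ L₂.Formula (ℕ ⊕ Unit)) := Encodable.ofCountable _
  let p₀ : P := ⟨φ, χ, h⟩
  let I := Order.idealOfCofinals p₀ C
  have hI : p₀ ∈ I := Order.mem_idealOfCofinals p₀ C
  have hC := Order.cofinal_meets_idealOfCofinals p₀ C
  have hD₁ : IsHenkinFilter.{u, v, x} (InsepPair.fst '' (I : Set P)) :=
    { nonempty := ⟨_, p₀, hI, rfl⟩
      directed := by
        rintro _ ⟨p, hp, rfl⟩ _ ⟨q, hq, rfl⟩
        obtain ⟨r, hr, hpr, hqr⟩ := I.directed p hp q hq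
        exact ⟨_, ⟨r, hr, rfl⟩, hpr.1, hqr.1⟩
      satisfiable := by
        rintro _ ⟨p, -, rfl⟩
        exact p.insep.satisfiable
      henkin := fun σ => by
        obtain ⟨p, h₁, h₂⟩ := hC (Sum.inl σ)
        exact ⟨_, ⟨p, h₂, rfl⟩, h₁⟩ }
  have hD₂ : IsHenkinFilter.{u, v, x} (InsepPair.snd '' (I : Set P)) :=
    { nonempty := ⟨_, p₀, hI, rfl⟩
      directed := by
        rintro _ ⟨p, hp, rfl⟩ _ ⟨q, hq, rfl⟩
        obtain ⟨r, hr, hpr, hqr⟩ := I.directed p hp q hq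
        exact ⟨_, ⟨r, hr, rfl⟩, hpr.2, hqr.2⟩
      satisfiable := by
        rintro _ ⟨p, -, rfl⟩
        exact p.insep.symm.satisfiable
      henkin := fun σ => by
        obtain ⟨p, h₁, h₂⟩ := hC (Sum.inr σ)
        exact ⟨_, ⟨p, h₂, rfl⟩, h₁⟩ }
  have agree : ∀ θ : L.Formula ℕ,
      (∃ φ ∈ InsepPair.fst '' (I : Set P), Entails.{u, v, x} φ (g₁.onFormula θ)) ↔
        ∃ φ ∈ InsepPair.snd '' (I : Set P), Entails.{u, v, x} φ (g₂.onFormula θ) := by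
    -- Two conflicting members of the ideal would have a common strengthening that `θ` separates.
    have common : ∀ p ∈ I, ∀ q ∈ I, ∀ θ : L.Formula ℕ, Entails.{u, v, x} p.fst (g₁.onFormula θ) →
        ¬ Entails.{u, v, x} q.snd (g₂.onFormula θ).not := by
      intro p hp q hq θ h₁ h₂
      obtain ⟨r, hr, hpr, hqr⟩ := I.directed p hp q hq
      exact r.insep θ (hpr.1.trans h₁) (hqr.2.trans h₂)
    have common' : ∀ p ∈ I, ∀ q ∈ I, ∀ θ : L.Formula ℕ,
        Entails.{u, v, x} p.fst (g₁.onFormula θ).not → ¬ Entails.{u, v, x} q.snd (g₂.onFormula θ) := by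
      intro p hp q hq θ h₁ h₂
      obtain ⟨r, hr, hpr, hqr⟩ := I.directed p hp q hq
      exact r.insep.symm θ (hqr.2.trans h₂) (hpr.1.trans h₁)
    intro θ
    constructor
    · rintro ⟨_, ⟨p, hp, rfl⟩, hθ⟩
      refine (hD₂.decides (g₂.onFormula θ)).resolve_right ?_
      rintro ⟨_, ⟨q, hq, rfl⟩, hn⟩
      exact common p hp q hq θ hθ hn
    · rintro ⟨_, ⟨q, hq, rfl⟩, hθ⟩
      refine (hD₁.decides (g₁.onFormula θ)).resolve_right ?_
      rintro ⟨_, ⟨p, hp, rfl⟩, hn⟩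
      exact common' p hp q hq θ hn hθ
  let K : Type y := ULift.{y} (Quotient hD₁.setoid)
  let c : ℕ → K := fun i => ⟨Quotient.mk _ i⟩
  have hc : Function.Surjective c := by
    rintro ⟨a⟩
    obtain ⟨i, rfl⟩ := Quotient.exists_rep a
    exact ⟨i, rfl⟩
  have heq : ∀ i j, c i = c j ↔ ∃ φ ∈ InsepPair.fst '' (I : Set P),
      Entails.{u, v, x} φ (Term.equal (Term.var i) (Term.var j)) := fun i j =>
    (ULift.up_injective.eq_iff).trans Quotient.eq
  obtain ⟨S₁, hS₁⟩ := hD₁.exists_structure c hc heq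
  obtain ⟨S₂, hS₂⟩ := hD₂.exists_structure c hc fun i j =>
    (heq i j).trans (agree (Term.equal (Term.var i) (Term.var j)))
  refine ⟨K, ?_, S₁, S₂, c, ?_, ?_, ?_⟩
  -- Every formula entails that some element differs from `x₀`, because entailment refers only to
  -- models with two elements.
  · let σ : L₁.Formula (ℕ ⊕ Unit) := (Term.equal (Term.var (Sum.inl 0)) (Term.var (Sum.inr ()))).not
    have : Sat S₁ (σ.iExs Unit) c := by
      refine (hS₁ _).2 ⟨_, ⟨p₀, hI, rfl⟩, fun M _ S s _ => ?_⟩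
      obtain ⟨a, ha⟩ := exists_ne (s 0)
      refine (sat_iExs S _ s).2 ⟨a, fun h => ha ?_⟩
      exact (Formula.realize_equal.1 h).symm
    obtain ⟨a, ha⟩ := (sat_iExs S₁ _ c).1 this
    exact ⟨c 0, a, fun h => ha (Formula.realize_equal.2 h)⟩
  · refine structure_ext_of_sat hc _ _ fun θ => ?_
    rw [← sat_onFormula, ← sat_onFormula, hS₁, hS₂, agree]
  · exact (hS₁ φ).2 ⟨φ, ⟨p₀, hI, rfl⟩, .refl φ⟩
  · exact (hS₂ χ).2 ⟨χ, ⟨p₀, hI, rfl⟩, .refl χ⟩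

end Inseparable

/-! ### Restriction to finitely many symbols -/

/-- The part of the signature `L` that consists of the symbols in `X`. -/
def sublanguage (L : FirstOrder.Language.{u, v}) (X : Set L.Symbols) : FirstOrder.Language.{u, v} :=
  ⟨fun n => {f : L.Functions n // Sum.inl ⟨n, f⟩ ∈ X},
    fun n => {r : L.Relations n // Sum.inr ⟨n, r⟩ ∈ X}⟩

section Sublanguage

variable {L : FirstOrder.Language.{u, v}} {P : FirstOrder.Language.{0, 0}} {X : Set L.Symbols}

/-- The inclusion of a part of a signature. -/
def inclusion (X : Set L.Symbols) : sublanguage L X →ᴸ L :=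
  ⟨fun _ f => f.1, fun _ r => r.1⟩

theorem countable_symbols_sublanguage (hX : X.Countable) : Countable (sublanguage L X).Symbols := by
  have := hX.to_subtype
  let g : (sublanguage L X).Symbols → X := fun s => match s with
    | Sum.inl ⟨n, f⟩ => ⟨Sum.inl ⟨n, f.1⟩, f.2⟩
    | Sum.inr ⟨n, r⟩ => ⟨Sum.inr ⟨n, r.1⟩, r.2⟩
  refine Function.Injective.countable (f := g) ?_
  rintro (⟨n, f, hf⟩ | ⟨n, f, hf⟩) (⟨m, f', hf'⟩ | ⟨m, f', hf'⟩) h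
  all_goals
    simp only [g, Subtype.mk.injEq, Sum.inl.injEq, Sum.inr.injEq, Sigma.mk.injEq, reduceCtorEq] at h
    try obtain ⟨rfl, h⟩ := h
    try obtain rfl := eq_of_heq h
    try rfl

theorem countable_symbols_sum {L₁ : FirstOrder.Language.{u, v}} {L₂ : FirstOrder.Language.{w, x}}
    [Countable L₁.Symbols] [Countable L₂.Symbols] : Countable (L₁.sum L₂).Symbols := by
  let g : (L₁.sum L₂).Symbols → L₁.Symbols ⊕ L₂.Symbols := fun s => match s with
    | Sum.inl ⟨n, Sum.inl f⟩ => Sum.inl (Sum.inl ⟨n, f⟩)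
    | Sum.inl ⟨n, Sum.inr f⟩ => Sum.inr (Sum.inl ⟨n, f⟩)
    | Sum.inr ⟨n, Sum.inl f⟩ => Sum.inl (Sum.inr ⟨n, f⟩)
    | Sum.inr ⟨n, Sum.inr f⟩ => Sum.inr (Sum.inr ⟨n, f⟩)
  refine Function.Injective.countable (f := g) ?_
  rintro (⟨n, f | f⟩ | ⟨n, f | f⟩) (⟨m, f' | f'⟩ | ⟨m, f' | f'⟩) h
  all_goals
    simp only [g, Sum.inl.injEq, Sum.inr.injEq, Sigma.mk.injEq, reduceCtorEq] at h
    try obtain ⟨rfl, h⟩ := h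
    try obtain rfl := eq_of_heq h
    try rfl

/-- The map on formulas with extra symbols that a part of a signature induces. -/
def inclusionSum (P : FirstOrder.Language.{0, 0}) (X : Set L.Symbols) :
    (sublanguage L X).sum P →ᴸ L.sum P :=
  (inclusion X).sumMap (LHom.id P)

/-- Allowing every larger set `Y` lets the supports of subexpressions be merged by unions, and later
lets two formulas be lifted to one common part. -/
theorem exists_finset_function_lift {n : ℕ} (f : (L.sum P).Functions n) :
    ∃ X : Finset L.Symbols, ∀ Y : Set L.Symbols, ↑X ⊆ Y →
      ∃ f', (inclusionSum P Y).onFunction f' = f := by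
  rcases f with f | f
  · exact ⟨{Sum.inl ⟨n, f⟩}, fun Y hY => ⟨Sum.inl ⟨f, hY (by simp)⟩, rfl⟩⟩
  · exact ⟨∅, fun Y _ => ⟨Sum.inr f, rfl⟩⟩

theorem exists_finset_relation_lift {n : ℕ} (r : (L.sum P).Relations n) :
    ∃ X : Finset L.Symbols, ∀ Y : Set L.Symbols, ↑X ⊆ Y →
      ∃ r', (inclusionSum P Y).onRelation r' = r := by
  rcases r with r | r
  · exact ⟨{Sum.inr ⟨n, r⟩}, fun Y hY => ⟨Sum.inl ⟨r, hY (by simp)⟩, rfl⟩⟩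
  · exact ⟨∅, fun Y _ => ⟨Sum.inr r, rfl⟩⟩

theorem exists_finset_term_lift {β : Type w} (t : (L.sum P).Term β) :
    ∃ X : Finset L.Symbols, ∀ Y : Set L.Symbols, ↑X ⊆ Y →
      ∃ t', (inclusionSum P Y).onTerm t' = t := by
  classical
  induction t with
  | var a => exact ⟨∅, fun Y _ => ⟨Term.var a, rfl⟩⟩
  | func f ts ih =>
    obtain ⟨X₁, h₁⟩ := exists_finset_function_lift f
    choose X hX using ih
    refine ⟨X₁ ∪ Finset.univ.biUnion X, fun Y hY => ?_⟩
    rw [Finset.coe_union, Set.union_subset_iff] at hY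
    obtain ⟨f', rfl⟩ := h₁ Y hY.1
    choose ts' hts using fun i => hX i Y (subset_trans
      (Finset.coe_subset.2 (Finset.subset_biUnion_of_mem X (Finset.mem_univ i))) hY.2)
    exact ⟨Term.func f' ts', by simp [LHom.onTerm, hts]⟩

theorem exists_finset_boundedFormula_lift {β : Type w} {n : ℕ} (φ : (L.sum P).BoundedFormula β n) :
    ∃ X : Finset L.Symbols, ∀ Y : Set L.Symbols, ↑X ⊆ Y →
      ∃ φ', (inclusionSum P Y).onBoundedFormula φ' = φ := by
  classical
  induction φ with
  | falsum => exact ⟨∅, fun Y _ => ⟨.falsum, rfl⟩⟩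
  | equal t₁ t₂ =>
    obtain ⟨X₁, h₁⟩ := exists_finset_term_lift t₁
    obtain ⟨X₂, h₂⟩ := exists_finset_term_lift t₂
    refine ⟨X₁ ∪ X₂, fun Y hY => ?_⟩
    rw [Finset.coe_union, Set.union_subset_iff] at hY
    obtain ⟨t₁', rfl⟩ := h₁ Y hY.1
    obtain ⟨t₂', rfl⟩ := h₂ Y hY.2
    exact ⟨.equal t₁' t₂', rfl⟩
  | rel r ts =>
    obtain ⟨X₁, h₁⟩ := exists_finset_relation_lift r
    choose X hX using fun i => exists_finset_term_lift (ts i)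
    refine ⟨X₁ ∪ Finset.univ.biUnion X, fun Y hY => ?_⟩
    rw [Finset.coe_union, Set.union_subset_iff] at hY
    obtain ⟨r', rfl⟩ := h₁ Y hY.1
    choose ts' hts using fun i => hX i Y (subset_trans
      (Finset.coe_subset.2 (Finset.subset_biUnion_of_mem X (Finset.mem_univ i))) hY.2)
    obtain rfl : (fun i => (inclusionSum P Y).onTerm (ts' i)) = ts := funext hts
    exact ⟨.rel r' ts', rfl⟩
  | imp φ₁ φ₂ ih₁ ih₂ =>
    obtain ⟨X₁, h₁⟩ := ih₁
    obtain ⟨X₂, h₂⟩ := ih₂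
    refine ⟨X₁ ∪ X₂, fun Y hY => ?_⟩
    rw [Finset.coe_union, Set.union_subset_iff] at hY
    obtain ⟨φ₁', rfl⟩ := h₁ Y hY.1
    obtain ⟨φ₂', rfl⟩ := h₂ Y hY.2
    exact ⟨.imp φ₁' φ₂', rfl⟩
  | all φ ih =>
    obtain ⟨X, h⟩ := ih
    refine ⟨X, fun Y hY => ?_⟩
    obtain ⟨φ', rfl⟩ := h Y hY
    exact ⟨.all φ', rfl⟩

/-- Symbols outside `X` are interpreted arbitrarily: functions as constant, relations as empty. -/
theorem exists_reduct_inclusion_eq {K : Type x} [Nonempty K] (S : (sublanguage L X).Structure K) :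
    ∃ _ : L.Structure K, (inclusion X).reduct K = S := by
  classical
  refine ⟨⟨fun {n} f xs => if h : Sum.inl ⟨n, f⟩ ∈ X then S.funMap ⟨f, h⟩ xs else Classical.arbitrary K,
    fun {n} r xs => ∃ h : Sum.inr ⟨n, r⟩ ∈ X, S.RelMap ⟨r, h⟩ xs⟩, ?_⟩
  ext n f xs
  · exact dif_pos f.2
  · exact ⟨fun ⟨_, h⟩ => h, fun h => ⟨f.2, h⟩⟩

end Sublanguage

/-! ### Craig interpolation -/

/-- The structure for a sum of signatures that two structures on the same type form. -/
@[reducible] def join {L : FirstOrder.Language.{u, v}} {P : FirstOrder.Language.{w, y}} {M : Type x}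
    (S : L.Structure M) (T : P.Structure M) : (L.sum P).Structure M :=
  Language.sumStructure L P M

theorem eq_join {L : FirstOrder.Language.{u, v}} {P : FirstOrder.Language.{w, y}} {M : Type x}
    (S : (L.sum P).Structure M) :
    S = join ((LHom.sumInl : L →ᴸ L.sum P).reduct M) ((LHom.sumInr : P →ᴸ L.sum P).reduct M) := by
  ext n f xs
  · rcases f with f | f <;> rfl
  · rcases f with f | f <;> rfl

/-- **Craig interpolation**, for formulas with disjoint countable sets of private symbols. -/
theorem exists_interpolant {L : FirstOrder.Language.{u, v}} {P₁ P₂ : FirstOrder.Language.{0, 0}}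
    [Countable P₁.Symbols] [Countable P₂.Symbols] {α : Type w}
    (ψ : (L.sum P₁).Formula α) (χ : (L.sum P₂).Formula α)
    (h : ∀ (M : Type x) [Nontrivial M] (S : L.Structure M) (T₁ : P₁.Structure M)
      (T₂ : P₂.Structure M) (s : α → M), Sat (join S T₁) ψ s → ¬ Sat (join S T₂) χ s) :
    ∃ θ : L.Formula α, ∀ (M : Type x) [Nontrivial M] (S : L.Structure M) (s : α → M),
      (∀ T₁ : P₁.Structure M, Sat (join S T₁) ψ s → Sat S θ s) ∧
        ∀ T₂ : P₂.Structure M, Sat (join S T₂) χ s → ¬ Sat S θ s := by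
  classical
  obtain ⟨X₁, hX₁⟩ := exists_finset_boundedFormula_lift ψ
  obtain ⟨X₂, hX₂⟩ := exists_finset_boundedFormula_lift χ
  let X : Set L.Symbols := ↑(X₁ ∪ X₂)
  obtain ⟨ψ', hψ'⟩ := hX₁ X (Finset.coe_subset.2 Finset.subset_union_left)
  obtain ⟨χ', hχ'⟩ := hX₂ X (Finset.coe_subset.2 Finset.subset_union_right)
  have := countable_symbols_sublanguage (X₁ ∪ X₂).countable_toSet
  have : Countable ((sublanguage L X).sum P₁).Symbols := countable_symbols_sum
  have : Countable ((sublanguage L X).sum P₂).Symbols := countable_symbols_sum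
  obtain ⟨t₁, ht₁⟩ := sat_congr_of_finset.{u, v, w, x} ψ
  obtain ⟨t₂, ht₂⟩ := sat_congr_of_finset.{u, v, w, x} χ
  obtain ⟨f, hf⟩ := Set.countable_iff_exists_injOn.1 (t₁ ∪ t₂).countable_toSet
  have hψ : ∀ (M : Type x) (S : (L.sum P₁).Structure M) (s : α → M),
      Sat S ψ s ↔ Sat ((inclusionSum P₁ X).reduct M) ψ' s := fun M S s => by
    rw [← sat_onFormula]; exact iff_of_eq (congrArg (Sat S · s) hψ'.symm)
  have hχ : ∀ (M : Type x) (S : (L.sum P₂).Structure M) (s : α → M),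
      Sat S χ s ↔ Sat ((inclusionSum P₂ X).reduct M) χ' s := fun M S s => by
    rw [← sat_onFormula]; exact iff_of_eq (congrArg (Sat S · s) hχ'.symm)
  let ψ₀ : ((sublanguage L X).sum P₁).Formula ℕ := Formula.relabel f ψ'
  let χ₀ : ((sublanguage L X).sum P₂).Formula ℕ := Formula.relabel f χ'
  have hsep : ¬ Insep.{u, v, x} (LHom.sumInl : sublanguage L X →ᴸ (sublanguage L X).sum P₁)
      (LHom.sumInl : sublanguage L X →ᴸ (sublanguage L X).sum P₂) ψ₀ χ₀ := by
    intro hins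
    -- Inseparability would give models of `ψ₀` and `χ₀` over one `L`-structure, against the
    -- hypothesis `h`.
    obtain ⟨K, _, S₁, S₂, c, hS, h₁, h₂⟩ := hins.exists_common_reduct.{u, v, x, x}
    obtain ⟨S, hS'⟩ := exists_reduct_inclusion_eq
      (@LHom.reduct _ _ (LHom.sumInl : sublanguage L X →ᴸ (sublanguage L X).sum P₁) K S₁)
    let T₁ := @LHom.reduct _ _ (LHom.sumInr : P₁ →ᴸ (sublanguage L X).sum P₁) K S₁
    let T₂ := @LHom.reduct _ _ (LHom.sumInr : P₂ →ᴸ (sublanguage L X).sum P₂) K S₂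
    have e₁ : S₁ = @LHom.reduct _ _ (inclusionSum P₁ X) K (join S T₁) := by
      refine (eq_join S₁).trans ?_
      rw [← hS']
      exact (eq_join (@LHom.reduct _ _ (inclusionSum P₁ X) K (join S T₁))).symm
    have e₂ : S₂ = @LHom.reduct _ _ (inclusionSum P₂ X) K (join S T₂) := by
      refine (eq_join S₂).trans ?_
      rw [← hS, ← hS']
      exact (eq_join (@LHom.reduct _ _ (inclusionSum P₂ X) K (join S T₂))).symm
    refine h K S T₁ T₂ (c ∘ f) ?_ ?_
    · rw [hψ, ← e₁]
      exact (sat_relabel S₁ ψ' f c).1 h₁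
    · rw [hχ, ← e₂]
      exact (sat_relabel S₂ χ' f c).1 h₂
  simp only [Insep, not_forall, not_not] at hsep
  obtain ⟨θ₀, hθ₁, hθ₂⟩ := hsep
  -- A left inverse of `f` on the relevant variables. All other variables of `θ₀` collapse to one
  -- that is then quantified away; its value is irrelevant to `ψ` and `χ`, and `α` may be empty.
  let g : ℕ → α ⊕ Unit := fun j =>
    if hj : ∃ a ∈ t₁ ∪ t₂, f a = j then Sum.inl hj.choose else Sum.inr ()
  have hg : ∀ a ∈ t₁ ∪ t₂, g (f a) = Sum.inl a := by
    intro a ha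
    have hj : ∃ b ∈ t₁ ∪ t₂, f b = f a := ⟨a, ha, rfl⟩
    simp only [g, dif_pos hj]
    rw [hf hj.choose_spec.1 ha hj.choose_spec.2]
  refine ⟨(Formula.relabel g ((inclusion X).onFormula θ₀)).iExs Unit, fun M _ S s => ?_⟩
  have hθ : Sat S ((Formula.relabel g ((inclusion X).onFormula θ₀)).iExs Unit) s ↔
      ∃ m : M, Sat ((inclusion X).reduct M) θ₀ (Sum.elim s (fun _ => m) ∘ g) := by
    rw [sat_iExs]
    exact exists_congr fun m => by rw [sat_relabel, sat_onFormula]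
  have hs : ∀ m : M, ∀ a ∈ t₁ ∪ t₂, s a = ((Sum.elim s (fun _ => m) ∘ g) ∘ f) a := fun m a ha => by
    simp [hg a ha]
  rw [hθ]
  constructor
  · intro T₁ hT
    obtain ⟨m⟩ : Nonempty M := inferInstance
    refine ⟨m, ?_⟩
    rw [ht₁ M _ _ _ fun a ha => hs m a (Finset.mem_union_left _ ha), hψ] at hT
    exact (sat_onFormula LHom.sumInl _ θ₀ _).1
      (hθ₁ M (@LHom.reduct _ _ (inclusionSum P₁ X) M (join S T₁)) _ ((sat_relabel _ ψ' f _).2 hT))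
  · rintro T₂ hT ⟨m, hm⟩
    rw [ht₂ M _ _ _ fun a ha => hs m a (Finset.mem_union_right _ ha), hχ] at hT
    exact hθ₂ M (@LHom.reduct _ _ (inclusionSum P₂ X) M (join S T₂)) _
      ((sat_relabel _ χ' f _).2 hT) ((sat_onFormula LHom.sumInl _ θ₀ _).2 hm)

/-! ### Existential second-order formulas as expansions -/

theorem realize_ofFirstOrder_iff_sat {L : FirstOrder.Language.{u, v}} {α : Type w} {M : Type x}
    (θ : L.Formula α) (S : L.Structure M) (s : α → M) :
    SOFormula.Realize (BoundedSOFormula.ofFirstOrder θ) S s ↔ Sat S θ s := by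
  rw [SOFormula.Realize, BoundedSOFormula.realize_ofFirstOrder]
  exact iff_of_eq (congrArg _ (Subsingleton.elim _ _))

instance (k : ℕ) : Countable (oneRel k).Symbols := by
  refine Function.Injective.countable (f := fun _ => ()) ?_
  rintro (⟨n, f⟩ | ⟨n, ⟨⟩⟩) (⟨m, f'⟩ | ⟨m, ⟨⟩⟩) -
  · exact f.elim
  · exact f.elim
  · exact f'.elim
  · rfl

/-- The structure with a single relation. -/
@[reducible] def ofSet {M : Type x} {k : ℕ} (Q : Set (Fin k → M)) : (oneRel k).Structure M where
  funMap f _ := Empty.elim f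
  RelMap r := match r with | RelSymbol.R => fun xs => xs ∈ Q

theorem expand_eq_join {L : FirstOrder.Language.{u, v}} {M : Type x} (S : L.Structure M) {k : ℕ}
    (Q : Set (Fin k → M)) : expand S Q = join S (ofSet Q) := by
  refine Structure.ext ?_ ?_
  · funext n f xs
    rcases f with f | f
    · rfl
    · exact f.elim
  · funext n r xs
    rcases r with r | r
    · rfl
    · cases r; rfl

theorem eq_ofSet {M : Type x} {k : ℕ} (T : (oneRel k).Structure M) :
    ∃ Q : Set (Fin k → M), T = ofSet Q := by
  refine ⟨{xs | T.RelMap (n := k) RelSymbol.R xs}, Structure.ext ?_ ?_⟩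
  · funext n f xs
    exact f.elim
  · funext n r xs
    cases r; rfl

theorem eq_expand {L : FirstOrder.Language.{u, v}} {M : Type x} {k : ℕ}
    (S : (addRel L k).Structure M) :
    ∃ (S₀ : L.Structure M) (Q : Set (Fin k → M)), S = expand S₀ Q := by
  let S' : (L.sum (oneRel k)).Structure M := S
  obtain ⟨Q, hQ⟩ := eq_ofSet (@LHom.reduct _ _ (LHom.sumInr : oneRel k →ᴸ L.sum (oneRel k)) M S')
  refine ⟨@LHom.reduct _ _ (LHom.sumInl : L →ᴸ L.sum (oneRel k)) M S', Q, ?_⟩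
  exact (expand_eq_join _ Q ▸ hQ ▸ eq_join S' :)

/-- Reassociation of a sum of three signatures. -/
def addRelAssoc (L : FirstOrder.Language.{u, v}) (k : ℕ) (P : FirstOrder.Language.{0, 0}) :
    (addRel L k).sum P →ᴸ L.sum ((oneRel k).sum P) :=
  LHom.sumElim (LHom.sumElim LHom.sumInl (LHom.sumInr.comp LHom.sumInl) : L.sum (oneRel k) →ᴸ _)
    (LHom.sumInr.comp LHom.sumInr)

theorem reduct_addRelAssoc {L : FirstOrder.Language.{u, v}} {k : ℕ} {P : FirstOrder.Language.{0, 0}}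
    {M : Type x} (S : L.Structure M) (Q : Set (Fin k → M)) (T : P.Structure M) :
    @LHom.reduct _ _ (addRelAssoc L k P) M (join S (join (ofSet Q) T)) = join (expand S Q) T := by
  rw [expand_eq_join]
  refine Structure.ext ?_ ?_
  · funext n f xs
    rcases f with (f | f) | f <;> rfl
  · funext n f xs
    rcases f with (f | f) | f <;> rfl

/-- An existential second-order formula asserts that a structure has an expansion to countably
many further symbols that satisfies a first-order formula. -/
theorem SOFormula.IsExistentialForm.exists_sat_join {L : FirstOrder.Language.{u, v}} {α : Type w}
    {φ : SOFormula L α} (hφ : φ.IsExistentialForm) :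
    ∃ (P : FirstOrder.Language.{0, 0}) (_ : Countable P.Symbols) (θ : (L.sum P).Formula α),
      ∀ (M : Type x) (S : L.Structure M) (s : α → M),
        φ.Realize S s ↔ ∃ T : P.Structure M, Sat (join S T) θ s := by
  induction hφ with
  | firstOrder θ =>
    refine ⟨Language.empty, ?_, LHom.sumInl.onFormula θ, fun M S s => ?_⟩
    · infer_instance
    · rw [realize_ofFirstOrder_iff_sat]
      exact ⟨fun h => ⟨default, (sat_onFormula _ _ _ _).2 h⟩,
        fun ⟨_, h⟩ => (sat_onFormula LHom.sumInl _ _ _).1 h⟩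
  | @exRel L k φ _ ih =>
    obtain ⟨P, _, θ, hθ⟩ := ih
    refine ⟨(oneRel k).sum P, countable_symbols_sum, (addRelAssoc L k P).onFormula θ,
      fun M S s => ?_⟩
    rw [SOFormula.Realize, BoundedSOFormula.realize_exRel]
    constructor
    · rintro ⟨Q, hQ⟩
      obtain ⟨T, hT⟩ := (hθ M _ s).1 hQ
      refine ⟨join (ofSet Q) T, ?_⟩
      rw [sat_onFormula, reduct_addRelAssoc]
      exact hT
    · rintro ⟨T, hT⟩
      obtain ⟨Q, hQ⟩ := eq_ofSet (@LHom.reduct _ _ LHom.sumInl M T)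
      rw [eq_join T, hQ, sat_onFormula, reduct_addRelAssoc] at hT
      exact ⟨_, (hθ M _ s).2 ⟨_, hT⟩⟩

theorem SOFormula.realize_not {L : FirstOrder.Language.{u, v}} {α : Type w} {M : Type x}
    (φ : SOFormula L α) (S : L.Structure M) (s : α → M) :
    SOFormula.Realize φ.not S s ↔ ¬ φ.Realize S s := Iff.rfl

theorem SOFormula.realize_or {L : FirstOrder.Language.{u, v}} {α : Type w} {M : Type x}
    (φ ψ : SOFormula L α) (S : L.Structure M) (s : α → M) :
    SOFormula.Realize (φ.or ψ) S s ↔ φ.Realize S s ∨ ψ.Realize S s :=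
  BoundedSOFormula.realize_or φ ψ S s _

/-! ### From interpolation to first-order definability -/

/-- If `φ` and `¬ φ ∨ ρ` are both `Σ¹₁`, where `ρ` is first-order and implies `φ`, then `φ` is
equivalent to a first-order formula. -/
theorem SOFormula.IsSigma11.isEquivFirstOrder {L : FirstOrder.Language.{u, v}} {α : Type w}
    {φ : SOFormula L α} (ρ : L.Formula α) (hφ : φ.IsSigma11)
    (hρ : SOFormula.IsSigma11 (φ.not.or (BoundedSOFormula.ofFirstOrder ρ)))
    (h : ∀ (M : Type (max u v w)) [Nontrivial M] (S : L.Structure M) (s : α → M),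
      Sat S ρ s → φ.Realize S s) : φ.IsEquivFirstOrder := by
  obtain ⟨ψ, hψ, hφψ⟩ := hφ
  obtain ⟨χ, hχ, hρχ⟩ := hρ
  obtain ⟨P₁, _, ψ₁, hψ₁⟩ := hψ.exists_sat_join.{u, v, w, max u v w}
  obtain ⟨P₂, _, χ₁, hχ₁⟩ := hχ.exists_sat_join.{u, v, w, max u v w}
  have h₁ : ∀ (M : Type (max u v w)) [Nontrivial M] (S : L.Structure M) (s : α → M),
      φ.Realize S s ↔ ∃ T : P₁.Structure M, Sat (join S T) ψ₁ s :=
    fun M _ S s => (hφψ M S s).trans (hψ₁ M S s)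
  have h₂ : ∀ (M : Type (max u v w)) [Nontrivial M] (S : L.Structure M) (s : α → M),
      (φ.Realize S s → Sat S ρ s) ↔ ∃ T : P₂.Structure M, Sat (join S T) χ₁ s :=
    fun M _ S s => by
      rw [← hχ₁, ← hρχ M S s, SOFormula.realize_or, realize_ofFirstOrder_iff_sat,
        SOFormula.realize_not, imp_iff_not_or]
  have hinl : ∀ (M : Type (max u v w)) (S : L.Structure M) (T : P₁.Structure M) (s : α → M),
      Sat (join S T) (ψ₁ ⊓ (LHom.sumInl.onFormula ρ).not) s ↔
        Sat (join S T) ψ₁ s ∧ ¬ Sat S ρ s := fun M S T s => by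
    rw [sat_inf, sat_not, sat_onFormula]; rfl
  -- The conjunct `¬ρ` is essential: where `ρ` holds, `φ` and `¬φ ∨ ρ` are both true, so `ψ₁` and
  -- `χ₁` are compatible there.
  obtain ⟨θ, hθ⟩ := exists_interpolant.{u, v, w, max u v w}
    (ψ₁ ⊓ (LHom.sumInl.onFormula ρ).not) χ₁ fun M _ S T₁ T₂ s hT₁ hT₂ => by
      rw [hinl] at hT₁
      exact hT₁.2 ((h₂ M S s).2 ⟨T₂, hT₂⟩ ((h₁ M S s).2 ⟨T₁, hT₁.1⟩))
  refine ⟨θ ⊔ ρ, fun M _ S s => ?_⟩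
  rw [realize_ofFirstOrder_iff_sat, sat_sup]
  constructor
  · intro hs
    by_cases hr : Sat S ρ s
    · exact Or.inr hr
    · obtain ⟨T, hT⟩ := (h₁ M S s).1 hs
      exact Or.inl ((hθ M S s).1 T ((hinl M S T s).2 ⟨hT, hr⟩))
  · rintro (hs | hs)
    · by_contra hn
      obtain ⟨T, hT⟩ := (h₂ M S s).1 fun h' => absurd h' hn
      exact (hθ M S s).2 T hT hs
    · exact h M S s hs

theorem SOFormula.IsEquivFirstOrder.isSigma11_not_or {L : FirstOrder.Language.{u, v}} {α : Type w}
    {φ : SOFormula L α} (ρ : L.Formula α) (hφ : φ.IsEquivFirstOrder) :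
    SOFormula.IsSigma11 (φ.not.or (BoundedSOFormula.ofFirstOrder ρ)) := by
  obtain ⟨θ, hθ⟩ := hφ
  refine ⟨_, .firstOrder (θ.not ⊔ ρ), fun M _ S s => ?_⟩
  rw [SOFormula.realize_or, SOFormula.realize_not, hθ M S s, realize_ofFirstOrder_iff_sat,
    realize_ofFirstOrder_iff_sat, realize_ofFirstOrder_iff_sat, sat_sup, sat_not]

theorem SOFormula.isSigma11_not_iff {L : FirstOrder.Language.{u, v}} {α : Type w}
    (φ : SOFormula L α) : SOFormula.IsSigma11 φ.not ↔
      SOFormula.IsSigma11 (φ.not.or (BoundedSOFormula.ofFirstOrder ⊥)) := by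
  refine exists_congr fun ψ => and_congr_right fun _ => ?_
  refine forall_congr' fun M => forall_congr' fun _ => forall_congr' fun S => forall_congr' fun s => ?_
  rw [SOFormula.realize_or, realize_ofFirstOrder_iff_sat, or_iff_left (sat_bot S s)]

end SecondOrder

theorem mainTheorem4 (L : FirstOrder.Language.{u, v}) (α : Type w) :
    (∀ (k : ℕ) (φ : SecondOrder.SOFormula (SecondOrder.addRel L k) α),
      φ.IsSigma11 →
      (∀ (M : Type (max u v w)) [Nontrivial M] (S : L.Structure M) (s : α → M),
        φ.Realize (SecondOrder.expand S (∅ : Set (Fin k → M))) s) →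
      (SecondOrder.SOFormula.IsSigma11
          (φ.not.or (SecondOrder.BoundedSOFormula.ofFirstOrder (SecondOrder.relEmpty L α k))) ↔
        φ.IsEquivFirstOrder)) ∧
    (∀ φ : SecondOrder.SOFormula L α,
      φ.IsSigma11 →
      (SecondOrder.SOFormula.IsSigma11 φ.not ↔ φ.IsEquivFirstOrder)) := by
  refine ⟨fun k φ hφ h => ⟨fun hρ => hφ.isEquivFirstOrder _ hρ fun M _ S s hs => ?_,
    fun hθ => hθ.isSigma11_not_or _⟩, fun φ hφ => ?_⟩
  -- Every `L(R)`-structure is some `(M, Q)`, and `relEmpty` forces `Q = ∅`, where `φ` holds by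
  -- assumption.
  · obtain ⟨S₀, Q, rfl⟩ := SecondOrder.eq_expand S
    rw [← SecondOrder.realize_ofFirstOrder_iff_sat, SecondOrder.realize_relEmpty] at hs
    subst hs
    exact h M S₀ s
  · rw [SecondOrder.SOFormula.isSigma11_not_iff]
    exact ⟨fun hρ => hφ.isEquivFirstOrder ⊥ hρ fun M _ S s hs => (SecondOrder.sat_bot S s hs).elim,
      fun hθ => hθ.isSigma11_not_or ⊥⟩
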